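/- Model of computation. A black-box operation is a polynomial $q\in\mathbb{C}[y_1,\dots,y_l]$ applied to $l$ complex numbers. Given a set $B$ of black-box operations and a set $C\subseteq\mathbb{C}$ of explicitly given constants, an algorithm is a finite directed acyclic graph with input nodes $x_1,\dots,x_k\in\mathbb{C}$ (given exactly), computational nodes, branching nodes (comparing two available values by any binary relation) and output nodes. A computational node either applies one of the operations $y_1y_2$, $y_1+y_2$, $y_1-y_2$ or an element of $B$ to available values, producing $q(a_1,\dots,a_l)(1+\delta_i)$ with its own rounding error $\delta_i\in\mathbb{C}$, or negates a value exactly, or loads exactly a constant from $C$. Let $p_{comp}(x,\delta)$ denote the output. A polynomial $p\in\mathbb{C}[x_1,\dots,x_k]$ can be accurately evaluated over the complex numbers (with $B$, $C$) if there is an algorithm with $p_{comp}(x,0)=p(x)$ for all $x\in\mathbb{C}^k$ such that for every $0<\eta<1$ there is $0<\epsilon<1$ with $$|p_{comp}(x,\delta)-p(x)|\le\eta\,|p(x)|\quad\text{for all }x\in\mathbb{C}^k\text{ and all }\delta\text{ with }|\delta_i|\le\epsilon\text{ for every }i.$$ Theorem. For each $n$ let $M_n(x)$ be an $n\times n$ complex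 matrix depending on $x\in\mathbb{C}^{k_n}$ whose determinant $p_n(x)=\det M_n(x)$ is a nonzero polynomial in $x$. Suppose that for every $n\ge 1$ the polynomial $p_n$ has an irreducible factor $\hat p_n\in\mathbb{C}[x_1,\dots,x_{k_n}]$ such that $\deg\hat p_n\to\infty$ as $n\to\infty$. Then for every enumerable set $B$ of black-box operations whose (total) degrees are bounded, and every set $C$ of constants, for all sufficiently large $n$ it is impossible to accurately evaluate $p_n$ over the complex numbers. -/

import Mathlib

namespace AccurateEvaluation

/-- A black-box operation: it takes `arity` complex inputs and returns the value of a fixed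
polynomial at these inputs (up to one rounding error, see `Algorithm.eval`). -/
structure BlackBox where
  arity : ℕ
  poly : MvPolynomial (Fin arity) ℂ

/-- The traditional operations: multiplication, addition and subtraction of two numbers. -/
def traditionalOps : Set BlackBox :=
  {⟨2, MvPolynomial.X 0 * MvPolynomial.X 1⟩,
   ⟨2, MvPolynomial.X 0 + MvPolynomial.X 1⟩,
   ⟨2, MvPolynomial.X 0 - MvPolynomial.X 1⟩}

/-- `Algorithm Q C m` is the part of a finite (possibly branching) algorithm that remains to be
run when the `m` values number `0, …, m - 1` (inputs and results of earlier steps) are available.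
`Q` is the set of available operations and `C` the set of explicitly given constants.
Every earlier value may be used any number of times, so this is a finite directed acyclic graph of
input, computational, branching and output nodes, in which the graph below a branching node
is written once for each of the two outcomes.

* `op q _ a next`: apply the operation `q` to the values number `a 0, a 1, …`;
* `neg i next`: negate value number `i`;
* `const c _ next`: load the constant `c`;
* `branch r i j yes no`: compare values number `i` and `j` by the relation `r`
  (any relation: equality, comparison of real parts, of moduli, …) and branch;
* `output i`: stop and return value number `i`.

Each of `op`, `neg`, `const` makes its result available as value number `m`. -/
inductive Algorithm (Q : Set BlackBox) (C : Set ℂ) : ℕ → Type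
  | output {m : ℕ} (i : Fin m) : Algorithm Q C m
  | op {m : ℕ} (q : BlackBox) (hq : q ∈ Q) (a : Fin q.arity → Fin m)
      (next : Algorithm Q C (m + 1)) : Algorithm Q C m
  | neg {m : ℕ} (i : Fin m) (next : Algorithm Q C (m + 1)) : Algorithm Q C m
  | const {m : ℕ} (c : ℂ) (hc : c ∈ C) (next : Algorithm Q C (m + 1)) : Algorithm Q C m
  | branch {m : ℕ} (r : ℂ → ℂ → Prop) (i j : Fin m) (yes no : Algorithm Q C m) :
      Algorithm Q C m

open Classical in
/-- The computed result, for the available values `v` and the rounding errors `δ`.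
An operation yields `q(a₀, a₁, …) (1 + δ)`, with its own error `δ`: the operation that produces
value number `m` has the error `δ m`, and these numbers are distinct along every run.
Negations, constants and comparisons are exact. -/
noncomputable def Algorithm.eval {Q : Set BlackBox} {C : Set ℂ} (δ : ℕ → ℂ) :
    {m : ℕ} → Algorithm Q C m → (Fin m → ℂ) → ℂ
  | _, .output i, v => v i
  | m, .op q _ a next, v =>
      next.eval δ (Fin.snoc v (MvPolynomial.eval (fun l => v (a l)) q.poly * (1 + δ m)))
  | _, .neg i next, v => next.eval δ (Fin.snoc v (-v i))
  | _, .const c _ next, v => next.eval δ (Fin.snoc v c)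
  | _, .branch r i j yes no, v => if r (v i) (v j) then yes.eval δ v else no.eval δ v

/-- `A` is an accurate algorithm for the evaluation of `p` on the domain `D`: it is exact in the
absence of rounding errors, and every relative error `η` can be achieved, uniformly on `D`, by
a suitable machine precision `ε`. The inputs are the values number `0, …, k - 1`. -/
def Algorithm.IsAccurate {Q : Set BlackBox} {C : Set ℂ} {k : ℕ} (A : Algorithm Q C k)
    (p : MvPolynomial (Fin k) ℂ) (D : Set (Fin k → ℂ)) : Prop :=
  (∀ x ∈ D, A.eval (fun _ => 0) x = MvPolynomial.eval x p) ∧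
  ∀ η : ℝ, 0 < η → η < 1 → ∃ ε : ℝ, 0 < ε ∧ ε < 1 ∧
    ∀ x ∈ D, ∀ δ : ℕ → ℂ, (∀ i, ‖δ i‖ ≤ ε) →
      ‖A.eval δ x - MvPolynomial.eval x p‖ ≤ η * ‖MvPolynomial.eval x p‖

/-- `p` can be accurately evaluated on `D` in the arithmetic extended by the black-box operations
`B` (in addition to the traditional ones and exact negation) and the constants `C`. -/
def AccuratelyEvaluable (B : Set BlackBox) (C : Set ℂ) {k : ℕ}
    (p : MvPolynomial (Fin k) ℂ) (D : Set (Fin k → ℂ)) : Prop :=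
  ∃ A : Algorithm (traditionalOps ∪ B) C k, A.IsAccurate p D

end AccurateEvaluation

namespace AccurateEvaluation

open MvPolynomial

/-! Let `h` be the irreducible factor, of degree above 2 and above the degrees of all black boxes.
An operation of degree below `deg h`, applied to independent quantities, cannot produce a value that
vanishes on all of `V(h)` unless it is identically zero. Where the exact result is nonzero, its free
rounding error turns it into an arbitrary number, so it serves as a fresh independent variable in
later steps. Hence, by induction (`Algorithm.exists_finset_eval`), every output is either 0 or the
value of one of finitely many polynomials in inputs and errors, none vanishing identically on
`V(h)`.

As `V(h)` is irreducible, some zero `x₀` of `h` and some arbitrarily small errors `δ` make all these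
polynomials nonzero at once. Fix `δ`. For `x` near `x₀` the value `p x` is small, so accuracy
excludes all the nonzero candidates. The output is then 0, which forces `p x = 0`. So `p` vanishes
on an open set, a contradiction. -/

theorem totalDegree_aeval_le_of_forall_le_one {R σ τ : Type*} [CommSemiring R]
    (q : MvPolynomial σ R) (f : σ → MvPolynomial τ R) (hf : ∀ i, (f i).totalDegree ≤ 1) :
    (aeval f q).totalDegree ≤ q.totalDegree := by
  rw [aeval_def, eval₂_eq]
  refine totalDegree_finsetSum_le fun s hs => ?_
  refine (totalDegree_mul _ _).trans ?_
  rw [algebraMap_eq, totalDegree_C, zero_add]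
  refine (totalDegree_finsetProd _ _).trans ?_
  refine le_trans (Finset.sum_le_sum fun i _ => ?_) (le_totalDegree hs)
  exact (totalDegree_pow _ _).trans (by simpa using Nat.mul_le_mul_left (s i) (hf i))

/-- A polynomial over `ℂ` that is not divisible by the irreducible polynomial `h` is nonzero at
some zero of `h`. -/
theorem exists_eval_eq_zero_and_eval_ne_zero {σ : Type*} [Finite σ] {h f : MvPolynomial σ ℂ}
    (hh : Irreducible h) (hf : ¬ h ∣ f) : ∃ x, eval x h = 0 ∧ eval x f ≠ 0 := by
  by_contra! H
  refine hf ?_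
  have hmem : f ∈ vanishingIdeal ℂ (zeroLocus ℂ (Ideal.span {h})) := by
    rw [zeroLocus_span]
    intro x hx
    exact H x (hx h rfl)
  rw [vanishingIdeal_zeroLocus_eq_radical] at hmem
  obtain ⟨N, hN⟩ := hmem
  exact hh.prime.dvd_of_dvd_pow (Ideal.mem_span_singleton.1 hN)

/-! ### Polynomials not vanishing identically on the zero set of an irreducible polynomial -/

section Nonvanishing

variable {σ τ : Type*}

/-- `f`, a polynomial in two groups of variables, does not vanish identically on the zero set
of `h`, a polynomial in the first group. -/
def NonvanishingOnZeros (h : MvPolynomial σ ℂ) (f : MvPolynomial (σ ⊕ τ) ℂ) : Prop :=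
  ∃ x y, eval x h = 0 ∧ eval (Sum.elim x y) f ≠ 0

/-- Specialization of the second group of variables. -/
noncomputable def specializeRight (y : τ → ℂ) :
    MvPolynomial (σ ⊕ τ) ℂ →ₐ[ℂ] MvPolynomial σ ℂ :=
  aeval (Sum.elim X fun j => C (y j))

/-- Specialization of the first group of variables. -/
noncomputable def specializeLeft (x : σ → ℂ) :
    MvPolynomial (σ ⊕ τ) ℂ →ₐ[ℂ] MvPolynomial τ ℂ :=
  aeval (Sum.elim (fun i => C (x i)) X)

theorem eval_aeval (x : σ → ℂ) (g : τ → MvPolynomial σ ℂ) (f : MvPolynomial τ ℂ) :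
    eval x (aeval g f) = eval (fun i => eval x (g i)) f := by
  induction f using MvPolynomial.induction_on with
  | C a => simp
  | add p q hp hq => rw [map_add, map_add, map_add, hp, hq]
  | mul_X p i hp => rw [map_mul, map_mul, map_mul, hp, aeval_X, eval_X]

@[simp]
theorem eval_specializeRight (x : σ → ℂ) (y : τ → ℂ) (f : MvPolynomial (σ ⊕ τ) ℂ) :
    eval x (specializeRight y f) = eval (Sum.elim x y) f := by
  rw [specializeRight, eval_aeval]
  congr 2
  funext i
  cases i <;> simp

@[simp]
theorem eval_specializeLeft (x : σ → ℂ) (y : τ → ℂ) (f : MvPolynomial (σ ⊕ τ) ℂ) :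
    eval y (specializeLeft x f) = eval (Sum.elim x y) f := by
  rw [specializeLeft, eval_aeval]
  congr 2
  funext i
  cases i <;> simp

/-- Some specialization of the second group is nonzero, and its degree is too small for a multiple
of `h`; the Nullstellensatz then gives the point. -/
theorem NonvanishingOnZeros.of_totalDegree_lt [Finite σ] {h : MvPolynomial σ ℂ}
    (hh : Irreducible h) {f : MvPolynomial (σ ⊕ τ) ℂ} (hf : f ≠ 0)
    (hdeg : f.totalDegree < h.totalDegree) : NonvanishingOnZeros h f := by
  obtain ⟨z, hz⟩ : ∃ z, eval z f ≠ 0 := by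
    by_contra! H
    exact hf (MvPolynomial.funext fun z => by simpa using H z)
  set y := z ∘ Sum.inr
  have hne : specializeRight y f ≠ 0 := by
    intro h0
    apply hz
    have := eval_specializeRight (z ∘ Sum.inl) y f
    rw [h0, Sum.elim_comp_inl_inr, map_zero] at this
    exact this.symm
  have hle : (specializeRight y f).totalDegree ≤ f.totalDegree :=
    totalDegree_aeval_le_of_forall_le_one _ _ fun i => by cases i <;> simp
  have hndvd : ¬ h ∣ specializeRight y f := fun hd =>
    absurd (totalDegree_le_of_dvd_of_isDomain hd hne) (by omega)
  obtain ⟨x, hx, hxf⟩ := exists_eval_eq_zero_and_eval_ne_zero hh hndvd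
  exact ⟨x, y, hx, by simpa using hxf⟩

/-- This is irreducibility of `V(h) × ℂ^τ`. Primality of `h` gives one `x` good for both factors,
still with separate `y₁`, `y₂`; for this `x` a common `y` exists because polynomials in `y` form a
domain. -/
theorem NonvanishingOnZeros.mul [Finite σ] {h : MvPolynomial σ ℂ}
    (hh : Irreducible h) {f g : MvPolynomial (σ ⊕ τ) ℂ} (hf : NonvanishingOnZeros h f)
    (hg : NonvanishingOnZeros h g) : NonvanishingOnZeros h (f * g) := by
  obtain ⟨x₁, y₁, hx₁, hf⟩ := hf
  obtain ⟨x₂, y₂, hx₂, hg⟩ := hg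
  have hndvd {x y} {f : MvPolynomial (σ ⊕ τ) ℂ} (hx : eval x h = 0)
      (hf : eval (Sum.elim x y) f ≠ 0) : ¬ h ∣ specializeRight y f := by
    rintro ⟨c, hc⟩
    rw [← eval_specializeRight, hc, map_mul, hx, zero_mul] at hf
    exact hf rfl
  obtain ⟨x, hx, hxfg⟩ := exists_eval_eq_zero_and_eval_ne_zero hh
    fun hd => (hh.prime.dvd_or_dvd hd).elim (hndvd hx₁ hf) (hndvd hx₂ hg)
  rw [map_mul, eval_specializeRight, eval_specializeRight] at hxfg
  have hne {y} {f : MvPolynomial (σ ⊕ τ) ℂ} (hf : eval (Sum.elim x y) f ≠ 0) :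
      specializeLeft (τ := τ) x f ≠ 0 := by
    intro h0
    rw [← eval_specializeLeft, h0, map_zero] at hf
    exact hf rfl
  have hprod : specializeLeft (τ := τ) x (f * g) ≠ 0 := by
    rw [map_mul]
    exact mul_ne_zero (hne (left_ne_zero_of_mul hxfg)) (hne (right_ne_zero_of_mul hxfg))
  obtain ⟨y, hy⟩ : ∃ y, eval y (specializeLeft (τ := τ) x (f * g)) ≠ 0 := by
    by_contra! H
    exact hprod (MvPolynomial.funext fun z => by simpa using H z)
  exact ⟨x, y, hx, by simpa using hy⟩

theorem NonvanishingOnZeros.prod [Finite σ] {h : MvPolynomial σ ℂ}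
    (hh : Irreducible h) (F : Finset (MvPolynomial (σ ⊕ τ) ℂ)) (hdeg : 0 < h.totalDegree)
    (hF : ∀ f ∈ F, NonvanishingOnZeros h f) : NonvanishingOnZeros h (∏ f ∈ F, f) :=
  Finset.prod_induction _ _ (fun _ _ hf hg => hf.mul hh hg)
    -- The empty product: 1 qualifies because `h` has a zero.
    (.of_totalDegree_lt hh one_ne_zero (by simpa using hdeg)) hF

/-- For fixed `x`, a polynomial in `y` that vanishes on a polydisc is zero, so `y` can be taken
small. -/
theorem NonvanishingOnZeros.exists_norm_le {h : MvPolynomial σ ℂ}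
    {f : MvPolynomial (σ ⊕ τ) ℂ} (hf : NonvanishingOnZeros h f) {ε : ℝ} (hε : 0 < ε) :
    ∃ x y, eval x h = 0 ∧ (∀ j, ‖y j‖ ≤ ε) ∧ eval (Sum.elim x y) f ≠ 0 := by
  obtain ⟨x, y, hx, hf⟩ := hf
  by_contra! H
  have h0 : specializeLeft (τ := τ) x f = 0 := by
    refine funext_set (fun _ => Metric.closedBall 0 ε)
      (fun _ => infinite_of_mem_nhds 0 (Metric.closedBall_mem_nhds 0 hε)) fun y hy => ?_
    rw [eval_specializeLeft, map_zero]
    exact H x y hx fun j => by simpa using hy j trivial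
  rw [← eval_specializeLeft, h0, map_zero] at hf
  exact hf rfl

end Nonvanishing

/-! ### Symbolic execution with rounded results as fresh variables -/

section Symbolic

variable {k : ℕ}

/-- `f` is of degree at most one and, as a function, depends only on the inputs and on the values
of the variables number `0, …, m - 1` of the second group. -/
structure IsSimpleBelow (m : ℕ) (f : MvPolynomial (Fin k ⊕ ℕ) ℂ) : Prop where
  totalDegree_le : f.totalDegree ≤ 1
  eval_congr : ∀ x w w', (∀ j < m, w j = w' j) → eval (Sum.elim x w) f = eval (Sum.elim x w') f

theorem IsSimpleBelow.mono {m n : ℕ} (hmn : m ≤ n) {f : MvPolynomial (Fin k ⊕ ℕ) ℂ}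
    (hf : IsSimpleBelow m f) : IsSimpleBelow n f :=
  ⟨hf.1, fun x w w' hw => hf.2 x w w' fun j hj => hw j (hj.trans_le hmn)⟩

theorem IsSimpleBelow.neg {m : ℕ} {f : MvPolynomial (Fin k ⊕ ℕ) ℂ}
    (hf : IsSimpleBelow m f) : IsSimpleBelow m (-f) :=
  ⟨by simpa using hf.1, fun x w w' hw => by simpa using hf.2 x w w' hw⟩

theorem isSimpleBelow_C (m : ℕ) (c : ℂ) :
    IsSimpleBelow m (C c : MvPolynomial (Fin k ⊕ ℕ) ℂ) :=
  ⟨by simp, by simp⟩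

theorem isSimpleBelow_X_inl (m : ℕ) (i : Fin k) :
    IsSimpleBelow m (X (Sum.inl i) : MvPolynomial (Fin k ⊕ ℕ) ℂ) :=
  ⟨by simp, by simp⟩

theorem isSimpleBelow_X_inr (m : ℕ) :
    IsSimpleBelow (m + 1) (X (Sum.inr m) : MvPolynomial (Fin k ⊕ ℕ) ℂ) :=
  ⟨by simp, fun x w w' hw => by simpa using hw m m.lt_succ_self⟩

theorem isSimpleBelow_snoc {m : ℕ} {ℓ : Fin m → MvPolynomial (Fin k ⊕ ℕ) ℂ}
    (hℓ : ∀ i, IsSimpleBelow m (ℓ i)) {f : MvPolynomial (Fin k ⊕ ℕ) ℂ}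
    (hf : IsSimpleBelow (m + 1) f) (i : Fin (m + 1)) :
    IsSimpleBelow (m + 1) (Fin.snoc (α := fun _ => MvPolynomial (Fin k ⊕ ℕ) ℂ) ℓ f i) := by
  refine Fin.lastCases ?_ (fun j => ?_) i
  · simpa using hf
  · simpa using (hℓ j).mono m.le_succ

theorem eval_snoc {m : ℕ} (ℓ : Fin m → MvPolynomial (Fin k ⊕ ℕ) ℂ)
    (f : MvPolynomial (Fin k ⊕ ℕ) ℂ) (z : Fin k ⊕ ℕ → ℂ) :
    (fun i => eval z (Fin.snoc (α := fun _ => MvPolynomial (Fin k ⊕ ℕ) ℂ) ℓ f i)) =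
      Fin.snoc (α := fun _ => ℂ) (fun i => eval z (ℓ i)) (eval z f) := by
  funext i
  refine Fin.lastCases ?_ (fun j => ?_) i <;> simp

/-- Errors numbered below `m` belong to steps already done. Their slots are thus free to hold
computed values in the symbolic execution. -/
theorem Algorithm.eval_congr {Q : Set BlackBox} {C : Set ℂ} {m : ℕ} (A : Algorithm Q C m)
    {δ δ' : ℕ → ℂ} (h : ∀ j, m ≤ j → δ j = δ' j) (v : Fin m → ℂ) :
    A.eval δ v = A.eval δ' v := by
  induction A with
  | output i => rfl
  | op q hq a next ih =>
    simp only [Algorithm.eval]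
    rw [h _ le_rfl, ih fun j hj => h j (by omega)]
  | neg i next ih =>
    simp only [Algorithm.eval]
    rw [ih fun j hj => h j (by omega)]
  | const c hc next ih =>
    simp only [Algorithm.eval]
    rw [ih fun j hj => h j (by omega)]
  | branch r i j yes no ih₁ ih₂ =>
    simp only [Algorithm.eval]
    rw [ih₁ h, ih₂ h]

/-- Replacing the variable number `m` of the second group by `g * (1 + X m)`. -/
noncomputable def roundSubst (m : ℕ) (g : MvPolynomial (Fin k ⊕ ℕ) ℂ) :
    MvPolynomial (Fin k ⊕ ℕ) ℂ →ₐ[ℂ] MvPolynomial (Fin k ⊕ ℕ) ℂ :=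
  aeval (Sum.elim (fun i => X (Sum.inl i))
    (Function.update (fun j => X (Sum.inr j)) m (g * (1 + X (Sum.inr m)))))

theorem eval_roundSubst (m : ℕ) (g f : MvPolynomial (Fin k ⊕ ℕ) ℂ) (x : Fin k → ℂ)
    (w : ℕ → ℂ) :
    eval (Sum.elim x w) (roundSubst m g f) =
      eval (Sum.elim x (Function.update w m (eval (Sum.elim x w) g * (1 + w m)))) f := by
  rw [roundSubst, eval_aeval]
  congr 2
  funext i
  rcases i with i | j
  · simp
  · by_cases hj : j = m
    · subst hj
      simp
    · simp [hj]

/-- At a point where `g` and `f` are both nonzero, the error can be chosen so that the rounded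
result equals the prescribed value of variable `m`; `g` itself is unaffected by this choice. -/
theorem NonvanishingOnZeros.roundSubst {h : MvPolynomial (Fin k) ℂ} (hh : Irreducible h)
    {m : ℕ} {g f : MvPolynomial (Fin k ⊕ ℕ) ℂ} (hg : NonvanishingOnZeros h g)
    (hgm : ∀ x w w', (∀ j < m, w j = w' j) → eval (Sum.elim x w) g = eval (Sum.elim x w') g)
    (hf : NonvanishingOnZeros h f) : NonvanishingOnZeros h (roundSubst m g f) := by
  obtain ⟨x, w, hx, hw⟩ := hg.mul hh hf
  rw [map_mul] at hw
  have hg0 := left_ne_zero_of_mul hw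
  refine ⟨x, Function.update w m (w m / eval (Sum.elim x w) g - 1), hx, ?_⟩
  have hgw : eval (Sum.elim x (Function.update w m (w m / eval (Sum.elim x w) g - 1))) g =
      eval (Sum.elim x w) g := hgm x _ w fun j hj => Function.update_of_ne hj.ne _ _
  rw [eval_roundSubst, hgw]
  simpa [mul_div_cancel₀ _ hg0] using right_ne_zero_of_mul hw

/-- The result of an algorithm all of whose operations have degree less than `deg h` is, for all
inputs and rounding errors, zero or the value of one of finitely many polynomials in the inputs and
rounding errors, none of which vanishes identically on the zero set of `h`. -/
theorem Algorithm.exists_finset_eval {Q : Set BlackBox} {K : Set ℂ}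
    {h : MvPolynomial (Fin k) ℂ} (hh : Irreducible h) (hdeg : 1 < h.totalDegree)
    (hQ : ∀ q ∈ Q, q.poly.totalDegree < h.totalDegree) {m : ℕ} (A : Algorithm Q K m)
    (ℓ : Fin m → MvPolynomial (Fin k ⊕ ℕ) ℂ) (hℓ : ∀ i, IsSimpleBelow m (ℓ i)) :
    ∃ F : Finset (MvPolynomial (Fin k ⊕ ℕ) ℂ), (∀ f ∈ F, NonvanishingOnZeros h f) ∧
      ∀ x w, A.eval w (fun i => MvPolynomial.eval (Sum.elim x w) (ℓ i)) = 0 ∨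
        ∃ f ∈ F, A.eval w (fun i => MvPolynomial.eval (Sum.elim x w) (ℓ i)) =
          MvPolynomial.eval (Sum.elim x w) f := by
  classical
  induction A with
  | output i =>
    by_cases h0 : ℓ i = 0
    · exact ⟨∅, by simp, fun x w => .inl (by simp [Algorithm.eval, h0])⟩
    · refine ⟨{ℓ i}, ?_, fun x w => .inr ⟨ℓ i, by simp, rfl⟩⟩
      simpa using NonvanishingOnZeros.of_totalDegree_lt hh h0 ((hℓ i).1.trans_lt hdeg)
  | @op m q hq a next ih =>
    set g := aeval (fun l => ℓ (a l)) q.poly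
    have hgval z : MvPolynomial.eval (fun l => MvPolynomial.eval z (ℓ (a l))) q.poly =
        MvPolynomial.eval z g := (eval_aeval _ _ _).symm
    simp only [Algorithm.eval, hgval]
    by_cases h0 : g = 0
    -- A relative error leaves an exact zero unchanged, so the result is the constant 0.
    · obtain ⟨F, hF, hFe⟩ := ih _ (isSimpleBelow_snoc hℓ (isSimpleBelow_C (m + 1) 0))
      refine ⟨F, hF, fun x w => ?_⟩
      simpa [eval_snoc, h0] using hFe x w
    · have hgN : NonvanishingOnZeros h g := .of_totalDegree_lt hh h0
        ((totalDegree_aeval_le_of_forall_le_one _ _ fun i => (hℓ _).1).trans_lt (hQ q hq))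
      have hgm : ∀ x w w', (∀ j < m, w j = w' j) →
          MvPolynomial.eval (Sum.elim x w) g = MvPolynomial.eval (Sum.elim x w') g := by
        intro x w w' hw
        rw [← hgval, ← hgval]
        congr 2
        funext l
        exact (hℓ (a l)).2 x w w' hw
      -- For the remaining steps variable `m` is the rounded result, which keeps all available
      -- values of degree at most one; `roundSubst` turns it back into the error.
      obtain ⟨F, hF, hFe⟩ := ih _ (isSimpleBelow_snoc hℓ (isSimpleBelow_X_inr m))
      refine ⟨F.image (roundSubst m g), ?_, fun x w => ?_⟩
      · intro f hf
        obtain ⟨f', hf', rfl⟩ := Finset.mem_image.1 hf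
        exact hgN.roundSubst hh hgm (hF f' hf')
      · set w' := Function.update w m (MvPolynomial.eval (Sum.elim x w) g * (1 + w m)) with hw'
        have hℓ' : (fun i => MvPolynomial.eval (Sum.elim x w') (ℓ i)) =
            fun i => MvPolynomial.eval (Sum.elim x w) (ℓ i) := by
          funext i
          exact (hℓ i).2 x _ _ fun j hj => Function.update_of_ne hj.ne _ _
        have key := hFe x w'
        rw [eval_snoc, hℓ', eval_X, Sum.elim_inr,
          next.eval_congr (δ' := w) fun j hj => Function.update_of_ne (by omega) _ _,
          hw', Function.update_self, ← hw'] at key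
        refine key.imp_right ?_
        rintro ⟨f, hf, hfe⟩
        exact ⟨_, Finset.mem_image_of_mem _ hf, hfe.trans (eval_roundSubst m g f x w).symm⟩
  | @neg m i next ih =>
    obtain ⟨F, hF, hFe⟩ := ih _ (isSimpleBelow_snoc hℓ ((hℓ i).neg.mono m.le_succ))
    exact ⟨F, hF, fun x w => by simpa [eval_snoc, Algorithm.eval] using hFe x w⟩
  | @const m c hc next ih =>
    obtain ⟨F, hF, hFe⟩ := ih _ (isSimpleBelow_snoc hℓ (isSimpleBelow_C (m + 1) c))
    exact ⟨F, hF, fun x w => by simpa [eval_snoc, Algorithm.eval] using hFe x w⟩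
  | branch r i j yes no ih₁ ih₂ =>
    -- The union covers both outcomes, so nothing about the relation matters.
    obtain ⟨F₁, hF₁, hFe₁⟩ := ih₁ ℓ hℓ
    obtain ⟨F₂, hF₂, hFe₂⟩ := ih₂ ℓ hℓ
    refine ⟨F₁ ∪ F₂, fun f hf => (Finset.mem_union.1 hf).elim (hF₁ f) (hF₂ f), fun x w => ?_⟩
    simp only [Algorithm.eval]
    split_ifs
    · exact (hFe₁ x w).imp_right fun ⟨f, hf, e⟩ => ⟨f, Finset.mem_union_left _ hf, e⟩
    · exact (hFe₂ x w).imp_right fun ⟨f, hf, e⟩ => ⟨f, Finset.mem_union_right _ hf, e⟩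

end Symbolic

/-! ### Impossibility of accurate evaluation -/

theorem totalDegree_le_two_of_mem_traditionalOps {q : BlackBox} (hq : q ∈ traditionalOps) :
    q.poly.totalDegree ≤ 2 := by
  rcases hq with rfl | rfl | rfl
  · exact (totalDegree_mul _ _).trans (by simp)
  · exact (totalDegree_add _ _).trans (by simp)
  · exact (totalDegree_sub _ _).trans (by simp)

/-- A nonzero polynomial with an irreducible factor of degree greater than two and than the degrees
of all black-box operations cannot be accurately evaluated. -/
theorem not_accuratelyEvaluable_of_irreducible_dvd {k : ℕ} {p h : MvPolynomial (Fin k) ℂ}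
    (hh : Irreducible h) (hp : p ≠ 0) (hdvd : h ∣ p) (hdeg : 2 < h.totalDegree)
    {B : Set BlackBox} (hB : ∀ q ∈ B, q.poly.totalDegree < h.totalDegree) {K : Set ℂ} :
    ¬ AccuratelyEvaluable B K p Set.univ := by
  rintro ⟨A, -, hA⟩
  obtain ⟨ε, hε, -, hacc⟩ := hA (1 / 2) (by norm_num) (by norm_num)
  obtain ⟨F, hF, hFe⟩ := A.exists_finset_eval hh (by omega)
    (fun q hq => hq.elim (fun hq => (totalDegree_le_two_of_mem_traditionalOps hq).trans_lt hdeg)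
      (hB q)) (fun i => X (Sum.inl i)) (isSimpleBelow_X_inl k)
  obtain ⟨x₀, δ, hx₀, hδ, hne⟩ :=
    (NonvanishingOnZeros.prod hh F (by omega) hF).exists_norm_le hε
  rw [map_prod, Finset.prod_ne_zero_iff] at hne
  have hp₀ : eval x₀ p = 0 := by
    obtain ⟨c, rfl⟩ := hdvd
    rw [map_mul, hx₀, zero_mul]
  -- With relative error 1/2 the output has modulus at most `3 / 2 * ‖eval x p‖`. At `x₀` this bound
  -- is 0, while every `f` in `F` is nonzero there.
  have hev : ∀ᶠ x in nhds x₀, ∀ f ∈ F, 3 / 2 * ‖eval x p‖ < ‖eval (Sum.elim x δ) f‖ := by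
    rw [Filter.eventually_all_finset]
    intro f hf
    have hc₁ : Continuous fun x : Fin k → ℂ => 3 / 2 * ‖eval x p‖ :=
      continuous_const.mul (MvPolynomial.continuous_eval p).norm
    have hc₂ : Continuous fun x : Fin k → ℂ => ‖eval (Sum.elim x δ) f‖ := by
      simp_rw [← eval_specializeRight]
      exact (MvPolynomial.continuous_eval _).norm
    refine hc₁.continuousAt.eventually_lt hc₂.continuousAt ?_
    simpa [hp₀] using hne f hf
  have hzero : ∀ᶠ x in nhds x₀, eval x p = 0 := by
    filter_upwards [hev] with x hx
    have hacc := hacc x trivial δ hδ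
    have hFx := hFe x δ
    simp only [eval_X, Sum.elim_inl] at hFx
    rcases hFx with h0 | ⟨f, hf, hfx⟩
    -- Output 0 means that `‖eval x p‖` is at most half of itself.
    · rw [h0, zero_sub, norm_neg] at hacc
      have := norm_nonneg (eval x p)
      exact norm_eq_zero.1 (by linarith)
    · rw [hfx] at hacc
      have h1 := hx f hf
      have h2 := norm_sub_norm_le (eval (Sum.elim x δ) f) (eval x p)
      linarith
  obtain ⟨r, hr, hball⟩ := Metric.eventually_nhds_iff.1 hzero
  refine hp (funext_set (fun i => Metric.ball (x₀ i) r)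
    (fun i => infinite_of_mem_nhds (x₀ i) (Metric.ball_mem_nhds _ hr)) fun x hx => ?_)
  rw [map_zero]
  exact hball ((dist_pi_lt_iff hr).2 fun i => hx i trivial)

end AccurateEvaluation

open AccurateEvaluation in
theorem mainTheorem10
    (k : ℕ → ℕ)
    (M : (n : ℕ) → (Fin (k n) → ℂ) → Matrix (Fin n) (Fin n) ℂ)
    (p : (n : ℕ) → MvPolynomial (Fin (k n)) ℂ)
    (hdet : ∀ n x, (M n x).det = MvPolynomial.eval x (p n))
    (hp : ∀ n, p n ≠ 0)
    (phat : (n : ℕ) → MvPolynomial (Fin (k n)) ℂ)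
    (hirr : ∀ n, 1 ≤ n → Irreducible (phat n))
    (hdvd : ∀ n, 1 ≤ n → phat n ∣ p n)
    (hdeg : Filter.Tendsto (fun n => (phat n).totalDegree) Filter.atTop Filter.atTop)
    (B : Set BlackBox) (hB : B.Countable)
    (d : ℕ) (hd : ∀ q ∈ B, q.poly.totalDegree ≤ d)
    (C : Set ℂ) :
    ∀ᶠ n in Filter.atTop, ¬ AccuratelyEvaluable B C (p n) Set.univ := by
  filter_upwards [hdeg.eventually_gt_atTop (max d 2), Filter.eventually_ge_atTop 1] with n hn hn1
  exact not_accuratelyEvaluable_of_irreducible_dvd (hirr n hn1) (hp n) (hdvd n hn1)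
    ((le_max_right d 2).trans_lt hn) fun q hq => (hd q hq).trans_lt ((le_max_left d 2).trans_lt hn)
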